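/- Let $\mathbb D=\{c\in\mathbb C:|c|<1\}$ and $F(c)=c^2+1-|c|^2$. In the coordinates $\xi=\log(1-|c|^2)\in(-\infty,0)$, $\theta=\arg c\in(-\pi,\pi]$, the map $F$ reads \[ \Psi(\xi,\theta)=\Big(\xi+\log(1-e^{\xi})+f(\theta),\ \arg\big(e^{2i\theta}+(1-e^{2i\theta})e^{\xi}\big)\Big),\qquad f(\theta)=\log(4\sin^2\theta). \] (a) For almost every initial point $(\xi_1,\theta_1)$ of the semi-infinite cylinder $(-\infty,0)\times(-\pi,\pi]$ (with respect to the uniform measure $d\xi\,d\theta$), the sequence $(\xi_{n+1},\theta_{n+1})=\Psi(\xi_n,\theta_n)$, $n\ge 1$, has (i) a subsequence that converges back to the initial point, $\lim_{m\to\infty}(\xi_{n_m},\theta_{n_m})=(\xi_1,\theta_1)$ (in particular $\xi_{n_m}\to\xi_1$), and (ii) another subsequence with $\lim_{m\to\infty}\xi_{n_m}=-\infty$. (b) Equivalently, for almost every initial point $c_1\in\mathbb D$ (with respect to area), the sequence $c_{n+1}=F(c_n)$, $n\ge 1$, has (i) a subsequence with $\lim_{m\to\infty}c_{n_m}=c_1$,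 and (ii) another subsequence with $\lim_{m\to\infty}|c_{n_m}|=1$. ($\Psi$ is defined, and all its iterates stay in the open cylinder, for almost every initial point; similarly the iterates of $F$ stay in $\mathbb D$ for almost every $c_1\in\mathbb D$.) -/

import Mathlib

/-- The disk map `F(c) = c² + 1 - |c|²`. -/
noncomputable def diskMap (c : ℂ) : ℂ := c ^ 2 + 1 - ((‖c‖ ^ 2 : ℝ) : ℂ)

/-- The angular increment `f(θ) = log (4 sin² θ)` of the variable `ξ = log (1 - |c|²)` under the
disk map; it comes from `1 - |F(c)|² = 4 (Im c)² (1 - |c|²)`. -/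
noncomputable def angularStep (θ : ℝ) : ℝ := Real.log (4 * Real.sin θ ^ 2)

/-- The disk map in the coordinates `ξ = log (1 - |c|²)`, `θ = arg c`:
`ξ' = ξ + log (1 - e^ξ) + f(θ)` and `θ' = arg (e^{2iθ} + (1 - e^{2iθ}) e^ξ)`. -/
noncomputable def cylinderMap (p : ℝ × ℝ) : ℝ × ℝ :=
  (p.1 + Real.log (1 - Real.exp p.1) + angularStep p.2,
   Complex.arg (Complex.exp (2 * p.2 * Complex.I)
      + (1 - Complex.exp (2 * p.2 * Complex.I)) * (Real.exp p.1 : ℂ)))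

/-- The semi-infinite cylinder `(-∞, 0) × S¹`, the circle being parametrized by the range
`(-π, π]` of the principal argument. -/
def cylinder : Set (ℝ × ℝ) := Set.Iio 0 ×ˢ Set.Ioc (-Real.pi) Real.pi

section

open MeasureTheory Filter Set Topology
open scoped ENNReal

/-! Write `s = 1 - |c|²`. The map is two-to-one, with fibres `{c, -c}`, and preserves the infinite
measure `dA / s` (`measurePreserving_diskMap`), which has the null sets of area on the disk. Both
claims are first proved for this measure.

Return to the initial point is conservativity plus Poincaré recurrence. As the measure is infinite,
conservativity needs an argument: a Lyapunov function `U ≥ 0` with sublevel sets of finite measure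
whose mean over the two preimages of a point exceeds its value there by at most an integrable error.
The preimages of a wandering set are disjoint and equal in measure, so they must drift to where `U`
is large, while the integrals of `U` over them stay bounded. Here `U = log (1 + 4 (1 - Re c)² / s)`;
see `lyapunov_add_neg_le`.

Approach to the boundary: the points whose orbits keep `s ≥ δ` form a set of finite measure, which
is therefore invariant mod null sets under both inverse branches. Images landing in the left
half-disk have more than doubled `s`, which is impossible indefinitely since `s ≤ 1`
(`ae_notMem_trappedSet`).

The cylinder statement follows by the change of coordinates. -/

/-! ### A Lyapunov criterion for conservativity in infinite measure. -/

theorem MeasureTheory.MeasurePreserving.conservative_of_lyapunov {α : Type*} [MeasurableSpace α]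
    {μ : Measure α} {f : α → α} (hf : MeasurePreserving f μ μ) {U e : α → ℝ≥0∞}
    (hU : Measurable U) (hU_top : ∀ x, U x ≠ ∞)
    (he_top : ∫⁻ x, e x ∂μ ≠ ∞) (hsub : ∀ K : ℕ, μ {x | U x ≤ K} ≠ ∞)
    (hdrift : ∀ s, MeasurableSet s →
      ∫⁻ x in f ⁻¹' s, U x ∂μ ≤ ∫⁻ x in s, U x ∂μ + ∫⁻ x in f ⁻¹' s, e x ∂μ) :
    Conservative f μ := by
  refine ⟨hf.quasiMeasurePreserving, fun s hs h0 => ?_⟩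
  by_contra hret
  push Not at hret
  -- Cutting the wandering set down to a sublevel set makes its measure finite and bounds `U` on it.
  obtain ⟨K, hK⟩ : ∃ K : ℕ, μ (s ∩ {x | U x ≤ K}) ≠ 0 := by
    by_contra! h
    refine h0 (measure_mono_null ?_ (measure_iUnion_null h))
    intro x hx
    obtain ⟨n, hn⟩ := ENNReal.exists_nat_gt (hU_top x)
    exact mem_iUnion.2 ⟨n, hx, hn.le⟩
  have hlevel : ∀ K : ℕ, MeasurableSet {x | U x ≤ K} := fun K => measurableSet_le hU measurable_const
  set t := s ∩ {x | U x ≤ K} with ht_def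
  have ht : MeasurableSet t := hs.inter (hlevel K)
  have htn : ∀ n, MeasurableSet (f^[n] ⁻¹' t) := fun n => (hf.iterate n).measurable ht
  have hμ : ∀ n, μ (f^[n] ⁻¹' t) = μ t := fun n =>
    (hf.iterate n).measure_preimage ht.nullMeasurableSet
  have ht_top : μ t ≠ ∞ := measure_ne_top_of_subset inter_subset_right (hsub K)
  have hlt : ∀ i j, i < j → Disjoint (f^[i] ⁻¹' t) (f^[j] ⁻¹' t) := by
    intro i j hij
    refine disjoint_left.2 fun x hi hj => hret _ hi.1 (j - i) (by omega) ?_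
    rw [← Function.iterate_add_apply, Nat.sub_add_cancel hij.le]
    exact hj.1
  have hdisj : Pairwise (Function.onFun Disjoint fun n => f^[n] ⁻¹' t) := by
    intro i j hij
    rcases lt_or_gt_of_ne hij with h | h
    · exact hlt i j h
    · exact (hlt j i h).symm
  have hbound : ∀ n, ∫⁻ x in f^[n] ⁻¹' t, U x ∂μ ≤
      ∫⁻ x in t, U x ∂μ + ∑ k ∈ Finset.range n, ∫⁻ x in f^[k + 1] ⁻¹' t, e x ∂μ := by
    intro n
    induction n with
    | zero => simp
    | succ n ih =>
      rw [Finset.sum_range_succ, ← add_assoc]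
      have h := hdrift _ (htn n)
      rw [← preimage_comp, ← Function.iterate_succ] at h
      exact h.trans (add_le_add_left ih _)
  have hsum : ∀ n, ∑ k ∈ Finset.range n, ∫⁻ x in f^[k + 1] ⁻¹' t, e x ∂μ ≤ ∫⁻ x, e x ∂μ := by
    intro n
    rw [← lintegral_biUnion_finset (t := fun k => f^[k + 1] ⁻¹' t)
      (fun i _ j _ hij => hdisj (by simpa using hij)) fun k _ => htn (k + 1)]
    exact setLIntegral_le_lintegral _ _
  have hU_t : ∫⁻ x in t, U x ∂μ ≤ K * μ t := by
    rw [← setLIntegral_const]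
    exact setLIntegral_mono measurable_const fun x hx => hx.2
  have hC : K * μ t + ∫⁻ x, e x ∂μ ≠ ∞ :=
    ENNReal.add_ne_top.2 ⟨ENNReal.mul_ne_top (ENNReal.natCast_ne_top K) ht_top, he_top⟩
  have hhalf : μ t / 2 ≠ 0 := by simpa using hK
  -- `L` is so large that half the mass of `t` at level above `L` would break the uniform bound on
  -- the integrals. Disjointness and finiteness of `{U ≤ L}` then give a preimage with less than
  -- half its mass there.
  obtain ⟨L, hL⟩ := ENNReal.exists_nat_mul_gt hhalf hC
  have hfin := Measure.finite_const_le_meas_of_disjoint_iUnion μ (pos_iff_ne_zero.2 hhalf)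
    (As := fun n => f^[n] ⁻¹' t ∩ {x | U x ≤ L}) (fun n => (htn n).inter (hlevel L))
    (fun i j hij => (hdisj hij).mono inter_subset_left inter_subset_left)
    (measure_ne_top_of_subset (iUnion_subset fun n => inter_subset_right) (hsub L))
  obtain ⟨n, hn⟩ := hfin.exists_notMem
  simp only [mem_ofPred_eq, not_le] at hn
  have hlarge : μ t / 2 ≤ μ (f^[n] ⁻¹' t \ {x | U x ≤ L}) := by
    by_contra! h
    have := measure_inter_add_sdiff (μ := μ) (f^[n] ⁻¹' t) (hlevel L)
    rw [hμ] at this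
    exact absurd (this ▸ ENNReal.add_lt_add hn h) (by simp [ENNReal.add_halves])
  refine lt_irrefl (K * μ t + ∫⁻ x, e x ∂μ) ?_
  calc _ < L * (μ t / 2) := hL
    _ ≤ L * μ (f^[n] ⁻¹' t \ {x | U x ≤ L}) := by gcongr
    _ = ∫⁻ _ in f^[n] ⁻¹' t \ {x | U x ≤ L}, (L : ℝ≥0∞) ∂μ := (setLIntegral_const _ _).symm
    _ ≤ ∫⁻ x in f^[n] ⁻¹' t \ {x | U x ≤ L}, U x ∂μ :=
      setLIntegral_mono hU fun x hx => (not_le.1 hx.2).le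
    _ ≤ ∫⁻ x in f^[n] ⁻¹' t, U x ∂μ := lintegral_mono_set sdiff_subset
    _ ≤ _ := (hbound n).trans (add_le_add hU_t (hsum n))

/-! ### Algebra and differential of the disk map. -/

/-- The boundary defect `1 - |c|²`, equal to `exp ξ`. -/
noncomputable def defect (c : ℂ) : ℝ := 1 - ‖c‖ ^ 2

lemma defect_eq (c : ℂ) : defect c = 1 - c.re ^ 2 - c.im ^ 2 := by
  rw [defect, Complex.sq_norm, Complex.normSq_apply]; ring

lemma defect_pos_iff {c : ℂ} : 0 < defect c ↔ c ∈ Metric.ball (0 : ℂ) 1 := by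
  rw [defect, mem_ball_zero_iff, sub_pos, sq_lt_one_iff₀ (norm_nonneg c)]

lemma continuous_defect : Continuous defect := by unfold defect; fun_prop

lemma defect_neg (c : ℂ) : defect (-c) = defect c := by simp [defect]

lemma diskMap_re (c : ℂ) : (diskMap c).re = 1 - 2 * c.im ^ 2 := by
  rw [diskMap, Complex.sq_norm, Complex.normSq_apply]; simp [pow_two]; ring

lemma diskMap_im (c : ℂ) : (diskMap c).im = 2 * c.re * c.im := by
  rw [diskMap, Complex.sub_im, Complex.ofReal_im]; simp [pow_two]; ring

lemma diskMap_neg (c : ℂ) : diskMap (-c) = diskMap c := by simp [diskMap]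

lemma defect_diskMap (c : ℂ) : defect (diskMap c) = 4 * c.im ^ 2 * defect c := by
  rw [defect_eq, defect_eq, diskMap_re, diskMap_im]; ring

lemma continuous_diskMap : Continuous diskMap := by unfold diskMap; fun_prop

noncomputable def diskMapDeriv (c : ℂ) : ℂ →L[ℝ] ℂ :=
  (Matrix.toLin Complex.basisOneI Complex.basisOneI
    !![0, -4 * c.im; 2 * c.im, 2 * c.re]).toContinuousLinearMap

lemma det_diskMapDeriv (c : ℂ) : (diskMapDeriv c).det = 8 * c.im ^ 2 := by
  simp only [diskMapDeriv, LinearMap.det_toContinuousLinearMap, LinearMap.det_toLin,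
    Matrix.det_fin_two_of]
  ring

lemma diskMapDeriv_apply (c v : ℂ) : diskMapDeriv c v =
    ⟨-4 * c.im * v.im, 2 * c.im * v.re + 2 * c.re * v.im⟩ := by
  simp only [diskMapDeriv, LinearMap.coe_toContinuousLinearMap', Matrix.toLin_apply]
  apply Complex.ext <;> simp <;> ring

lemma hasFDerivAt_diskMap (c : ℂ) : HasFDerivAt diskMap (diskMapDeriv c) c := by
  have hre := Complex.reCLM.hasFDerivAt (x := c)
  have him := Complex.imCLM.hasFDerivAt (x := c)
  have h := (Complex.equivRealProdCLM.symm.toContinuousLinearMap.hasFDerivAt.comp c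
    (((hasFDerivAt_const (1 : ℝ) c).sub ((him.pow 2).const_mul 2)).prodMk
      ((hre.mul him).const_mul 2)))
  refine (h.congr_fderiv ?_).congr_of_eventuallyEq (Eventually.of_forall fun z => ?_)
  · ext
    all_goals
      simp [diskMapDeriv_apply]
      ring_nf
      rfl
  · apply Complex.ext <;> simp [diskMap_re, diskMap_im, mul_assoc]

def upperHalfDisk : Set ℂ := Metric.ball 0 1 ∩ {c | 0 < c.im}

lemma measurableSet_upperHalfDisk : MeasurableSet upperHalfDisk :=
  Metric.isOpen_ball.measurableSet.inter
    (isOpen_lt continuous_const Complex.continuous_im).measurableSet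

lemma injOn_diskMap : InjOn diskMap upperHalfDisk := by
  intro c hc d hd h
  have hc' : 0 < c.im := hc.2
  have hd' : 0 < d.im := hd.2
  have h1 := congrArg Complex.re h
  have h2 := congrArg Complex.im h
  rw [diskMap_re, diskMap_re] at h1
  rw [diskMap_im, diskMap_im] at h2
  have h3 : c.im = d.im := by nlinarith
  rw [h3] at h2
  exact Complex.ext (by nlinarith) h3

lemma image_diskMap_upperHalfDisk : diskMap '' upperHalfDisk = Metric.ball 0 1 := by
  apply subset_antisymm
  · rintro _ ⟨c, hc, rfl⟩
    have h1 := defect_pos_iff.2 hc.1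
    have h2 : 0 < c.im := hc.2
    rw [← defect_pos_iff, defect_diskMap]
    positivity
  · intro w hw
    have h := defect_pos_iff.2 hw
    rw [defect_eq] at h
    have hu : 0 < (1 - w.re) / 2 := by nlinarith [sq_nonneg w.im, sq_nonneg (w.re - 1)]
    set y := √((1 - w.re) / 2)
    have hy : 0 < y := Real.sqrt_pos.2 hu
    have hy2 : y ^ 2 = (1 - w.re) / 2 := Real.sq_sqrt hu.le
    have hw' : diskMap ⟨w.im / (2 * y), y⟩ = w := by
      apply Complex.ext
      · rw [diskMap_re]; simp only; rw [hy2]; ring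
      · rw [diskMap_im]; simp only; field_simp
    refine ⟨_, ⟨?_, hy⟩, hw'⟩
    have hd := defect_diskMap ⟨w.im / (2 * y), y⟩
    rw [hw'] at hd
    rw [← defect_pos_iff]
    have : 0 < defect w := defect_pos_iff.2 hw
    rw [hd] at this
    exact (pos_iff_pos_of_mul_pos this).1 (by positivity)

/-! ### The invariant measure and its null sets. -/

/-- The invariant measure `dA / (1 - |c|²)` of the disk map, i.e. `dξ dθ / 2`. -/
noncomputable def diskMeasure : Measure ℂ :=
  (volume.restrict (Metric.ball 0 1)).withDensity fun c => ENNReal.ofReal (defect c)⁻¹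

lemma measurable_density : Measurable fun c : ℂ => ENNReal.ofReal (defect c)⁻¹ :=
  (continuous_defect.measurable.inv).ennreal_ofReal

lemma lintegral_diskMeasure {g : ℂ → ℝ≥0∞} (hg : Measurable g) :
    ∫⁻ c, g c ∂diskMeasure =
      ∫⁻ c in Metric.ball 0 1, ENNReal.ofReal (defect c)⁻¹ * g c := by
  rw [diskMeasure, lintegral_withDensity_eq_lintegral_mul _ measurable_density hg]
  rfl

lemma ae_volume_linear_ne_zero {L : ℂ →ₗ[ℝ] ℝ} (hL : L ≠ 0) :
    ∀ᵐ c : ℂ, L c ≠ 0 := by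
  have : (LinearMap.ker L) ≠ ⊤ := by rwa [Ne, LinearMap.ker_eq_top]
  rw [ae_iff]
  convert Measure.addHaar_submodule volume _ this using 2
  ext c
  simp

lemma ae_volume_im_ne_zero : ∀ᵐ c : ℂ, c.im ≠ 0 :=
  ae_volume_linear_ne_zero (L := Complex.imLm)
    fun h => by simpa using LinearMap.congr_fun h Complex.I

lemma ae_volume_re_ne_zero : ∀ᵐ c : ℂ, c.re ≠ 0 :=
  ae_volume_linear_ne_zero (L := Complex.reLm)
    fun h => by simpa using LinearMap.congr_fun h 1

lemma measurePreserving_neg_ball :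
    MeasurePreserving (fun c : ℂ => -c) (volume.restrict (Metric.ball 0 1))
      (volume.restrict (Metric.ball 0 1)) := by
  have h := (Measure.measurePreserving_neg (volume : Measure ℂ)).restrict_preimage
    (s := Metric.ball (0 : ℂ) 1) Metric.isOpen_ball.measurableSet
  have hs : Neg.neg ⁻¹' Metric.ball (0 : ℂ) 1 = Metric.ball 0 1 := by ext; simp
  rwa [hs] at h

lemma lintegral_ball_of_even {h : ℂ → ℝ≥0∞} (hm : Measurable h) (heven : ∀ c, h (-c) = h c) :
    ∫⁻ c in Metric.ball 0 1, h c = 2 * ∫⁻ c in upperHalfDisk, h c := by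
  have hup : MeasurableSet {c : ℂ | 0 < c.im} :=
    (isOpen_lt continuous_const Complex.continuous_im).measurableSet
  rw [← lintegral_add_compl h hup, two_mul]
  have h1 : ∫⁻ c in {c : ℂ | 0 < c.im}, h c ∂(volume.restrict (Metric.ball 0 1)) =
      ∫⁻ c in upperHalfDisk, h c := by
    rw [Measure.restrict_restrict hup, inter_comm]; rfl
  have h2 : ∫⁻ c in {c : ℂ | 0 < c.im}ᶜ, h c ∂(volume.restrict (Metric.ball 0 1)) =
      ∫⁻ c in {c : ℂ | 0 < c.im}, h c ∂(volume.restrict (Metric.ball 0 1)) := by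
    have h3 := measurePreserving_neg_ball.setLIntegral_comp_preimage hup hm
    simp only [heven] at h3
    rw [← h3]
    refine setLIntegral_congr (ae_restrict_of_ae (ae_volume_im_ne_zero.mono fun c hc => ?_))
    simp only [eq_iff_iff]
    change ¬ (0 < c.im) ↔ 0 < (-c).im
    rw [Complex.neg_im, not_lt, neg_pos]
    exact ⟨fun h => lt_of_le_of_ne h hc, le_of_lt⟩
  rw [h2, h1]

/-- By evenness the two branches contribute equally, so one integrates twice over the upper
half-disk, which maps bijectively onto the disk. With `y = Im c`, the Jacobian `8y²` over the new
defect `4y² s` is `2 / s`, matching the factor two. -/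
theorem measurePreserving_diskMap : MeasurePreserving diskMap diskMeasure diskMeasure := by
  refine ⟨continuous_diskMap.measurable, Measure.ext_of_lintegral _ fun g hg => ?_⟩
  have hgF : Measurable fun c => g (diskMap c) := hg.comp continuous_diskMap.measurable
  have hm : Measurable fun c => ENNReal.ofReal (defect c)⁻¹ * g (diskMap c) :=
    measurable_density.mul hgF
  rw [lintegral_map hg continuous_diskMap.measurable, lintegral_diskMeasure hgF,
    lintegral_diskMeasure hg, lintegral_ball_of_even hm
      (fun c => by simp only [defect_neg, diskMap_neg]),
    ← image_diskMap_upperHalfDisk,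
    lintegral_image_eq_lintegral_abs_det_fderiv_mul volume measurableSet_upperHalfDisk
      (fun c _ => (hasFDerivAt_diskMap c).hasFDerivWithinAt) injOn_diskMap,
    ← lintegral_const_mul _ hm]
  refine setLIntegral_congr_fun measurableSet_upperHalfDisk fun c hc => ?_
  have h1 := defect_pos_iff.2 hc.1
  have h2 : 0 < c.im := hc.2
  rw [det_diskMapDeriv, defect_diskMap, ← mul_assoc, ← mul_assoc, ← ENNReal.ofReal_mul (abs_nonneg _),
    ← ENNReal.ofReal_ofNat 2, ← ENNReal.ofReal_mul (by norm_num), abs_of_pos (by positivity)]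
  congr 2
  field_simp
  norm_num

lemma measurePreserving_neg_diskMeasure :
    MeasurePreserving (fun c : ℂ => -c) diskMeasure diskMeasure := by
  refine ⟨measurable_neg, Measure.ext_of_lintegral _ fun g hg => ?_⟩
  have hgn : Measurable fun c => g (-c) := hg.comp measurable_neg
  rw [lintegral_map hg measurable_neg, lintegral_diskMeasure hgn, lintegral_diskMeasure hg,
    ← measurePreserving_neg_ball.lintegral_comp
      (f := fun c => ENNReal.ofReal (defect c)⁻¹ * g c) (measurable_density.mul hg)]
  simp only [defect_neg]

lemma diskMeasure_absolutelyContinuous : diskMeasure ≪ volume.restrict (Metric.ball 0 1) :=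
  withDensity_absolutelyContinuous _ _

lemma absolutelyContinuous_diskMeasure : volume.restrict (Metric.ball 0 1) ≪ diskMeasure := by
  refine withDensity_absolutelyContinuous' measurable_density.aemeasurable ?_
  filter_upwards [ae_restrict_mem Metric.isOpen_ball.measurableSet] with c hc
  have := defect_pos_iff.2 hc
  simpa using this

lemma ae_diskMeasure_of_ae {p : ℂ → Prop} (h : ∀ᵐ c, p c) : ∀ᵐ c ∂diskMeasure, p c :=
  diskMeasure_absolutelyContinuous.ae_le (ae_restrict_of_ae h)

lemma ae_diskMeasure_mem_ball : ∀ᵐ c ∂diskMeasure, c ∈ Metric.ball (0 : ℂ) 1 :=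
  diskMeasure_absolutelyContinuous.ae_le (ae_restrict_mem Metric.isOpen_ball.measurableSet)

lemma ae_diskMeasure_iterate {p : ℂ → Prop} (h : ∀ᵐ c ∂diskMeasure, p c) :
    ∀ᵐ c ∂diskMeasure, ∀ n, p (diskMap^[n] c) :=
  ae_all_iff.2 fun n => (measurePreserving_diskMap.iterate n).quasiMeasurePreserving.ae h

lemma ae_diskMeasure_orbit :
    ∀ᵐ c ∂diskMeasure, ∀ n, 0 < defect (diskMap^[n] c) ∧ (diskMap^[n] c).im ≠ 0 := by
  refine ae_diskMeasure_iterate (p := fun c => 0 < defect c ∧ c.im ≠ 0) ?_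
  filter_upwards [ae_diskMeasure_mem_ball, ae_diskMeasure_of_ae ae_volume_im_ne_zero] with c h1 h2
  exact ⟨defect_pos_iff.2 h1, h2⟩

/-! ### Almost every orbit approaches the boundary circle. -/

/-- Points whose whole orbit keeps a defect at least `δ`. -/
def trappedSet (δ : ℝ) : Set ℂ := {c | ∀ n, δ ≤ defect (diskMap^[n] c)}

lemma measurableSet_trappedSet (δ : ℝ) : MeasurableSet (trappedSet δ) := by
  have : trappedSet δ = ⋂ n, (fun c => defect (diskMap^[n] c)) ⁻¹' Ici δ := by
    ext; simp [trappedSet]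
  rw [this]
  exact MeasurableSet.iInter fun n =>
    (continuous_defect.comp (continuous_diskMap.iterate n)).measurable measurableSet_Ici

lemma mapsTo_trappedSet (δ : ℝ) : MapsTo diskMap (trappedSet δ) (trappedSet δ) := fun c hc n => by
  rw [← Function.iterate_succ_apply]; exact hc (n + 1)

lemma diskMeasure_defect_ge_ne_top {δ : ℝ} (hδ : 0 < δ) :
    diskMeasure {c | δ ≤ defect c} ≠ ∞ := by
  have hm : MeasurableSet {c | δ ≤ defect c} :=
    continuous_defect.measurable measurableSet_Ici
  rw [diskMeasure, withDensity_apply _ hm, ← lt_top_iff_ne_top]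
  calc _ ≤ ∫⁻ _ in {c | δ ≤ defect c}, ENNReal.ofReal δ⁻¹ ∂(volume.restrict (Metric.ball 0 1)) :=
        setLIntegral_mono measurable_const fun c hc =>
          ENNReal.ofReal_le_ofReal (inv_anti₀ hδ hc)
    _ ≤ ∫⁻ _, ENNReal.ofReal δ⁻¹ ∂(volume.restrict (Metric.ball (0 : ℂ) 1)) :=
        setLIntegral_le_lintegral _ _
    _ < ∞ := by
        rw [lintegral_const, Measure.restrict_apply_univ]
        exact ENNReal.mul_lt_top ENNReal.ofReal_lt_top measure_ball_lt_top

/-- The trapped set is contained in its preimage and both have the same finite measure, so they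
agree almost everywhere. -/
lemma ae_mem_trappedSet_of_diskMap_mem {δ : ℝ} (hδ : 0 < δ) :
    ∀ᵐ c ∂diskMeasure, diskMap c ∈ trappedSet δ → c ∈ trappedSet δ := by
  have hμ := measurePreserving_diskMap.measure_preimage
    (measurableSet_trappedSet δ).nullMeasurableSet
  have htop : diskMeasure (trappedSet δ) ≠ ∞ :=
    measure_ne_top_of_subset (fun c hc => hc 0) (diskMeasure_defect_ge_ne_top hδ)
  have h : trappedSet δ =ᵐ[diskMeasure] diskMap ⁻¹' trappedSet δ :=
    ae_eq_of_subset_of_measure_ge (mapsTo_trappedSet δ) hμ.le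
    (measurableSet_trappedSet δ).nullMeasurableSet (by rwa [hμ])
  exact h.symm.le

lemma ae_of_ae_diskMap {p : ℂ → Prop} (hp : MeasurableSet {c | p c})
    (h : ∀ᵐ c ∂diskMeasure, p (diskMap c)) : ∀ᵐ c ∂diskMeasure, p c := by
  rw [← measurePreserving_diskMap.map_eq]
  exact (ae_map_iff continuous_diskMap.measurable.aemeasurable hp).2 h

/-- By invariance of the measure it suffices to check the bound at `diskMap c`. Both `c` and `-c`
are then trapped, and one of them lies on the left, so the previous bound applies to their common
defect. The image lies on the left only if `2 (Im c)² > 1`, and then the factor `4 (Im c)²` exceeds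
two. -/
lemma ae_two_pow_mul_le_defect {δ : ℝ} (hδ : 0 < δ) (n : ℕ) :
    ∀ᵐ c ∂diskMeasure, c ∈ trappedSet δ → c.re < 0 → 2 ^ n * δ ≤ defect c := by
  induction n with
  | zero => exact Eventually.of_forall fun c hc _ => by simpa using hc 0
  | succ n ih =>
    have hm : MeasurableSet {c : ℂ | c ∈ trappedSet δ → c.re < 0 → 2 ^ (n + 1) * δ ≤ defect c} :=
      (measurableSet_trappedSet δ).imp
        ((measurableSet_lt Complex.measurable_re measurable_const).imp
          (measurableSet_le measurable_const continuous_defect.measurable))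
    refine ae_of_ae_diskMap hm ?_
    have hback := ae_mem_trappedSet_of_diskMap_mem hδ
    have hneg := measurePreserving_neg_diskMeasure.quasiMeasurePreserving
    filter_upwards [ih, hneg.ae ih, hback, hneg.ae hback,
      ae_diskMeasure_of_ae ae_volume_re_ne_zero] with c h1 h2 h3 h4 h5 hc hre
    rw [diskMap_neg] at h4
    rw [defect_neg] at h2
    have hd : 2 ^ n * δ ≤ defect c := by
      rcases lt_or_gt_of_ne h5 with h | h
      · exact h1 (h3 hc) h
      · exact h2 (h4 hc) (by simpa using h)
    rw [diskMap_re] at hre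
    have : 0 < 2 ^ n * δ := by positivity
    rw [defect_diskMap, pow_succ]
    nlinarith

lemma ae_notMem_trappedSet {δ : ℝ} (hδ : 0 < δ) : ∀ᵐ c ∂diskMeasure, c ∉ trappedSet δ := by
  obtain ⟨n, hn⟩ := pow_unbounded_of_one_lt δ⁻¹ (one_lt_two (α := ℝ))
  have hleft : ∀ᵐ c ∂diskMeasure, c ∈ trappedSet δ → ¬ c.re < 0 := by
    filter_upwards [ae_two_pow_mul_le_defect hδ n] with c h hc hre
    have h1 : 1 < 2 ^ n * δ := (inv_lt_iff_one_lt_mul₀ hδ).1 hn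
    have h2 : defect c ≤ 1 := by unfold defect; nlinarith [sq_nonneg ‖c‖]
    linarith [h hc hre]
  have hback := ae_mem_trappedSet_of_diskMap_mem hδ
  have hneg := measurePreserving_neg_diskMeasure.quasiMeasurePreserving
  filter_upwards [hleft, hneg.ae hleft, hneg.ae hback, ae_diskMeasure_of_ae ae_volume_re_ne_zero]
    with c h1 h2 h3 h4 hc
  rw [diskMap_neg] at h3
  rcases lt_or_gt_of_ne h4 with h | h
  · exact h1 hc h
  · exact h2 (h3 (mapsTo_trappedSet δ hc)) (by simpa using h)

theorem ae_subseq_defect_tendsto_zero : ∀ᵐ c ∂diskMeasure, ∃ n : ℕ → ℕ, StrictMono n ∧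
    Tendsto (fun m => defect (diskMap^[n m] c)) atTop (𝓝 0) := by
  have h : ∀ᵐ c ∂diskMeasure, ∀ k : ℕ, c ∉ trappedSet (1 / (k + 1)) :=
    ae_all_iff.2 fun k => ae_notMem_trappedSet Nat.one_div_pos_of_nat
  filter_upwards [ae_diskMeasure_iterate h, ae_diskMeasure_orbit] with c hc hpos
  have hcl : MapClusterPt (0 : ℝ) atTop fun n => defect (diskMap^[n] c) := by
    refine mapClusterPt_iff_frequently.2 fun s hs => frequently_atTop.2 fun N => ?_
    obtain ⟨ε, hε, hs⟩ := Metric.mem_nhds_iff.1 hs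
    obtain ⟨k, hk⟩ := exists_nat_one_div_lt hε
    -- Non-trapping is applied to the `N`-th iterate, so small defects occur at arbitrarily late
    -- times.
    have := hc N k
    simp only [trappedSet, mem_ofPred_eq, not_forall, not_le] at this
    obtain ⟨n, hn⟩ := this
    rw [← Function.iterate_add_apply] at hn
    refine ⟨n + N, by omega, hs ?_⟩
    rw [Real.ball_eq_Ioo]
    constructor <;> linarith [(hpos (n + N)).1]
  obtain ⟨φ, hφ, h⟩ := hcl.tendsto_subseq
  exact ⟨φ, hφ, h⟩

/-! ### Conservativity: the Lyapunov function and its integrable error. -/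

lemma lintegral_abs_sin_rpow_lt_top :
    ∫⁻ θ in Ioo (-Real.pi) Real.pi, ENNReal.ofReal (|Real.sin θ| ^ (-1 / 2 : ℝ)) < ∞ := by
  have hhalf : IntervalIntegrable (fun θ => |Real.sin θ| ^ (-1 / 2 : ℝ)) volume
      (-(Real.pi / 2)) (Real.pi / 2) := by
    have hx : IntervalIntegrable (fun x : ℝ => (2 / Real.pi * |x|) ^ (-1 / 2 : ℝ)) volume
        (-(Real.pi / 2)) (Real.pi / 2) := by
      refine intervalIntegrable_of_even (fun x => by simp only [abs_neg]) (fun x hx => ?_) (by simp) (by simp)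
      have h := (intervalIntegral.intervalIntegrable_rpow' (a := 0) (b := x)
        (show (-1 : ℝ) < -1 / 2 by norm_num)).const_mul ((2 / Real.pi) ^ (-1 / 2 : ℝ))
      refine h.congr fun y hy => ?_
      rw [uIoc_of_le hx.le] at hy
      rw [abs_of_pos hy.1, Real.mul_rpow (by positivity) hy.1.le]
    refine hx.mono_fun' (Measurable.aestronglyMeasurable (by fun_prop)) ?_
    rw [uIoc_of_le (by linarith [Real.pi_pos])]
    have hne : ∀ᵐ x : ℝ, x ≠ 0 := by simp [ae_iff]
    filter_upwards [ae_restrict_mem measurableSet_Ioc, ae_restrict_of_ae hne] with x hx hx0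
    rw [Real.norm_of_nonneg (by positivity)]
    exact Real.rpow_le_rpow_of_nonpos (by positivity)
      (Real.mul_abs_le_abs_sin (abs_le.2 ⟨hx.1.le, hx.2⟩)) (by norm_num)
  have hper : Function.Periodic (fun θ => |Real.sin θ| ^ (-1 / 2 : ℝ)) Real.pi := fun θ => by
    simp [Real.sin_add_pi]
  have h := hper.intervalIntegrable (t := -(Real.pi / 2)) Real.pi_ne_zero
    (by rwa [show -(Real.pi / 2) + Real.pi = Real.pi / 2 by ring]) (-Real.pi) Real.pi
  rw [intervalIntegrable_iff_integrableOn_Ioo_of_le (by linarith [Real.pi_pos])] at h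
  exact h.lintegral_lt_top

lemma lintegral_one_sub_rpow_lt_top :
    ∫⁻ r in Ioo (0 : ℝ) 1, ENNReal.ofReal ((1 - r) ^ (-7 / 8 : ℝ)) < ∞ := by
  have h := (intervalIntegral.intervalIntegrable_rpow' (a := 1) (b := 0)
    (show (-1 : ℝ) < -7 / 8 by norm_num)).comp_sub_left 1
  rw [sub_self, sub_zero, intervalIntegrable_iff_integrableOn_Ioo_of_le zero_le_one] at h
  exact h.lintegral_lt_top

/-- An integrable function controlling the failure of the Lyapunov function to be superharmonic. -/
noncomputable def lyapunovError (c : ℂ) : ℝ := defect c ^ (1 / 8 : ℝ) * |c.im| ^ (-1 / 2 : ℝ)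

lemma measurable_lyapunovError : Measurable lyapunovError := by
  have := continuous_defect.measurable
  have := Complex.measurable_im
  unfold lyapunovError
  fun_prop

/-- Dividing by the defect leaves the exponent `-7/8` at the boundary and `-1/2` on the real axis,
both above `-1`. In polar coordinates the integrand is dominated by a product of one-variable
functions. -/
lemma lintegral_lyapunovError_lt_top :
    ∫⁻ c, ENNReal.ofReal (lyapunovError c) ∂diskMeasure < ∞ := by
  rw [lintegral_diskMeasure measurable_lyapunovError.ennreal_ofReal,
    ← lintegral_indicator Metric.isOpen_ball.measurableSet,
    ← Complex.lintegral_comp_polarCoord_symm]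
  set A : ℝ → ℝ≥0∞ := (Ioo (0 : ℝ) 1).indicator fun r => ENNReal.ofReal ((1 - r) ^ (-7 / 8 : ℝ))
    with hA
  set B : ℝ → ℝ≥0∞ := fun θ => ENNReal.ofReal (|Real.sin θ| ^ (-1 / 2 : ℝ)) with hB
  have hAm : Measurable A := Measurable.indicator (by fun_prop) measurableSet_Ioo
  have hBm : Measurable B := by fun_prop
  calc _ ≤ ∫⁻ p in polarCoord.target, A p.1 * B p.2 := by
        refine setLIntegral_mono (by fun_prop) fun p hp => ?_
        obtain ⟨r, θ⟩ := p
        have hr : 0 < r := hp.1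
        by_cases hr1 : r < 1
        · have hn : ‖Complex.polarCoord.symm (r, θ)‖ = r := by
            rw [Complex.norm_polarCoord_symm]; exact abs_of_pos hr
          have him : (Complex.polarCoord.symm (r, θ)).im = r * Real.sin θ := by
            simp [Complex.polarCoord_symm_apply, Complex.sin_ofReal_re]
          have hs : 0 < 1 - r ^ 2 := by nlinarith
          have hAr : A r = ENNReal.ofReal ((1 - r) ^ (-7 / 8 : ℝ)) :=
            indicator_of_mem (show r ∈ Ioo (0 : ℝ) 1 from ⟨hr, hr1⟩) _
          simp only []
          rw [indicator_of_mem (by rwa [mem_ball_zero_iff, hn]), hAr, hB, smul_eq_mul,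
            lyapunovError, defect, hn, him, abs_mul, abs_of_pos hr,
            Real.mul_rpow hr.le (abs_nonneg _), ← ENNReal.ofReal_mul (by positivity),
            ← ENNReal.ofReal_mul hr.le, ← ENNReal.ofReal_mul (Real.rpow_nonneg (by linarith) _)]
          refine ENNReal.ofReal_le_ofReal ?_
          have e1 : (1 - r ^ 2)⁻¹ * (1 - r ^ 2) ^ (1 / 8 : ℝ) = (1 - r ^ 2) ^ (-7 / 8 : ℝ) := by
            rw [← Real.rpow_neg_one, ← Real.rpow_add hs]; norm_num
          have e2 : r * r ^ (-1 / 2 : ℝ) = r ^ (1 / 2 : ℝ) := by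
            nth_rewrite 1 [← Real.rpow_one r]
            rw [← Real.rpow_add hr]; norm_num
          calc _ = (r * r ^ (-1 / 2 : ℝ)) * ((1 - r ^ 2)⁻¹ * (1 - r ^ 2) ^ (1 / 8 : ℝ)) *
                |Real.sin θ| ^ (-1 / 2 : ℝ) := by ring
            _ ≤ 1 * (1 - r) ^ (-7 / 8 : ℝ) * |Real.sin θ| ^ (-1 / 2 : ℝ) := by
                rw [e1, e2]
                gcongr ?_ * ?_ * _
                · exact Real.rpow_le_one hr.le hr1.le (by norm_num)
                · exact Real.rpow_le_rpow_of_nonpos (by linarith) (by nlinarith) (by norm_num)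
            _ = _ := by rw [one_mul]
        · rw [indicator_of_notMem]
          · simp
          · rw [mem_ball_zero_iff, Complex.norm_polarCoord_symm]
            simpa [abs_of_pos hr] using hr1
    _ = (∫⁻ r in Ioi 0, A r) * ∫⁻ θ in Ioo (-Real.pi) Real.pi, B θ := by
        rw [polarCoord_target, Measure.volume_eq_prod, ← Measure.prod_restrict]
        exact lintegral_prod_mul hAm.aemeasurable hBm.aemeasurable
    _ < ∞ := by
        refine ENNReal.mul_lt_top ?_ lintegral_abs_sin_rpow_lt_top
        refine (setLIntegral_le_lintegral _ _).trans_lt ?_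
        rw [lintegral_indicator measurableSet_Ioo]
        exact lintegral_one_sub_rpow_lt_top

/-- A Lyapunov function for the backward random walk of the disk map. -/
noncomputable def lyapunov (c : ℂ) : ℝ := Real.log (1 + 4 * (1 - c.re) ^ 2 / defect c)

lemma measurable_lyapunov : Measurable lyapunov := by
  have := continuous_defect.measurable
  have := Complex.measurable_re
  unfold lyapunov
  fun_prop

lemma rpow_one_eighth_eq {c : ℂ} (hs : 0 < defect c) :
    (defect c / c.im ^ 4) ^ (1 / 8 : ℝ) = lyapunovError c := by
  rw [lyapunovError, Real.div_rpow hs.le (by positivity),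
    ← Even.pow_abs (by decide : Even 4) c.im, ← Real.rpow_natCast,
    ← Real.rpow_mul (abs_nonneg _), div_eq_mul_inv, ← Real.rpow_neg (abs_nonneg _)]
  norm_num

lemma log_one_add_le {z : ℝ} (hz : 0 ≤ z) : Real.log (1 + z) ≤ 8 * z ^ (1 / 8 : ℝ) := by
  have h1 : (1 + z) ^ (1 / 8 : ℝ) ≤ 1 + z ^ (1 / 8 : ℝ) := by
    simpa using Real.rpow_add_le_add_rpow zero_le_one hz (by norm_num : (0 : ℝ) ≤ 1 / 8)
      (by norm_num)
  have h2 := Real.log_rpow (show 0 < 1 + z by linarith) (1 / 8)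
  have h3 := Real.log_le_sub_one_of_pos (show 0 < (1 + z) ^ (1 / 8 : ℝ) by positivity)
  linarith

lemma lyapunov_nonneg {c : ℂ} (hs : 0 < defect c) : 0 ≤ lyapunov c :=
  Real.log_nonneg (by have : 0 ≤ 4 * (1 - c.re) ^ 2 / defect c := by positivity
                      linarith)

lemma lyapunov_diskMap {c : ℂ} (hs : 0 < defect c) (hy : c.im ≠ 0) :
    lyapunov (diskMap c) = Real.log (1 + 4 * c.im ^ 2 / defect c) := by
  rw [lyapunov, diskMap_re, defect_diskMap]
  congr 2
  field_simp
  ring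

/-- With `c = x + iy`, the identity `1 - x² = y² + s` shows that the product of the two arguments of
the logarithm has leading term `16 y⁴ / s²`, as does the square of the argument at the image. The
remaining difference is at most `64 / s`, a relative error of at most `4s / y⁴`. -/
lemma lyapunov_add_neg_le {c : ℂ} (hs : 0 < defect c) (hy : c.im ≠ 0) :
    lyapunov c + lyapunov (-c) ≤ 2 * lyapunov (diskMap c) + 16 * lyapunovError c := by
  have hx := defect_eq c
  set s := defect c with hs_def
  have hy2 : 0 < c.im ^ 2 := by positivity
  have hA : 0 < 1 + 4 * (1 - c.re) ^ 2 / s := by positivity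
  have hB : 0 < 1 + 4 * (1 - (-c).re) ^ 2 / s := by positivity
  have hD : 0 < 1 + 4 * c.im ^ 2 / s := by positivity
  have hz : 0 ≤ 4 * (s / c.im ^ 4) := by positivity
  have hE : 0 < 1 + 4 * (s / c.im ^ 4) := by positivity
  have key : (1 + 4 * (1 - c.re) ^ 2 / s) * (1 + 4 * (1 - (-c).re) ^ 2 / s) ≤
      (1 + 4 * c.im ^ 2 / s) ^ 2 * (1 + 4 * (s / c.im ^ 4)) := by
    have h1 : (1 + 4 * (1 - c.re) ^ 2 / s) * (1 + 4 * (1 - (-c).re) ^ 2 / s) =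
        (1 + 4 * c.im ^ 2 / s) ^ 2 + (8 + 8 * c.re ^ 2 + 24 * c.im ^ 2 + 16 * s) / s := by
      rw [Complex.neg_re]
      have hx2 : c.re ^ 2 = 1 - c.im ^ 2 - s := by linarith
      field_simp
      have : (s + 4 * (1 - c.re) ^ 2) * (s + 4 * (1 - -c.re) ^ 2) =
        s ^ 2 + 8 * s * (1 + c.re ^ 2) + 16 * (1 - c.re ^ 2) ^ 2 := by ring
      rw [this, hx2]; ring
    have h2 : (8 + 8 * c.re ^ 2 + 24 * c.im ^ 2 + 16 * s) / s ≤ 64 / s := by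
      gcongr
      nlinarith [sq_nonneg c.re]
    have h3 : 64 / s = (4 * c.im ^ 2 / s) ^ 2 * (4 * (s / c.im ^ 4)) := by
      field_simp; norm_num
    have h4 : (4 * c.im ^ 2 / s) ^ 2 * (4 * (s / c.im ^ 4)) ≤
        (1 + 4 * c.im ^ 2 / s) ^ 2 * (4 * (s / c.im ^ 4)) := by
      gcongr; linarith
    rw [h1]; linarith
  have hlog := Real.log_le_log (mul_pos hA hB) key
  rw [Real.log_mul hA.ne' hB.ne', Real.log_mul (by positivity) hE.ne', Real.log_pow] at hlog
  have herr : Real.log (1 + 4 * (s / c.im ^ 4)) ≤ 16 * lyapunovError c := by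
    refine (log_one_add_le hz).trans ?_
    rw [Real.mul_rpow (by norm_num) (by positivity), rpow_one_eighth_eq hs]
    have h4 : (4 : ℝ) ^ (1 / 8 : ℝ) ≤ 2 := by
      calc (4 : ℝ) ^ (1 / 8 : ℝ) ≤ 4 ^ (1 / 2 : ℝ) :=
            Real.rpow_le_rpow_of_exponent_le (by norm_num) (by norm_num)
        _ = 2 := by
            rw [← Real.sqrt_eq_rpow, show (4 : ℝ) = 2 ^ 2 by norm_num]
            exact Real.sqrt_sq (by norm_num)
    have : 0 ≤ lyapunovError c := by
      rw [← rpow_one_eighth_eq hs]; positivity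
    nlinarith
  rw [lyapunov_diskMap hs hy, lyapunov, lyapunov, defect_neg]
  push_cast at hlog
  linarith

/-- In the disk `y² ≤ 2 (1 - x)`, so `U ≤ K` forces `y⁴ ≤ e^K s`. The error function is thus bounded
below on the sublevel set, and Markov's inequality applies. -/
lemma diskMeasure_lyapunov_le_ne_top (K : ℕ) :
    diskMeasure {c | ENNReal.ofReal (lyapunov c) ≤ K} ≠ ∞ := by
  have hle : ∀ᵐ c ∂diskMeasure, c ∈ {c | ENNReal.ofReal (lyapunov c) ≤ K} →
      1 ≤ ENNReal.ofReal (Real.exp K ^ (1 / 8 : ℝ) * lyapunovError c) := by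
    filter_upwards [ae_diskMeasure_orbit] with c hc hK
    obtain ⟨hs, hy⟩ := hc 0
    simp only [Function.iterate_zero, id] at hs hy
    have hK' : lyapunov c ≤ K := by
      have := ENNReal.toReal_mono (ENNReal.natCast_ne_top K) hK
      rwa [ENNReal.toReal_ofReal (lyapunov_nonneg hs), ENNReal.toReal_natCast] at this
    have hpos : 0 ≤ 4 * (1 - c.re) ^ 2 / defect c := by positivity
    have h1 := (Real.log_le_iff_le_exp (by linarith)).1 hK'
    have h2 : 4 * (1 - c.re) ^ 2 ≤ Real.exp K * defect c := by
      rw [← div_le_iff₀ hs]; linarith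
    have hx := defect_eq c
    have h3 : c.im ^ 2 ≤ 2 * (1 - c.re) := by nlinarith [sq_nonneg (c.re - 1)]
    have hy2 : 0 < c.im ^ 2 := by positivity
    have h4 : 1 ≤ Real.exp K * (defect c / c.im ^ 4) := by
      rw [← mul_div_assoc, one_le_div (by positivity)]
      nlinarith
    have h5 := Real.one_le_rpow h4 (show (0 : ℝ) ≤ 1 / 8 by norm_num)
    rw [Real.mul_rpow (by positivity) (by positivity), rpow_one_eighth_eq hs] at h5
    exact ENNReal.one_le_ofReal.2 h5
  have hm : MeasurableSet {c | ENNReal.ofReal (lyapunov c) ≤ K} :=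
    measurableSet_le measurable_lyapunov.ennreal_ofReal measurable_const
  rw [← lt_top_iff_ne_top, ← setLIntegral_one]
  calc _ ≤ ∫⁻ c in {c | ENNReal.ofReal (lyapunov c) ≤ K},
        ENNReal.ofReal (Real.exp K ^ (1 / 8 : ℝ) * lyapunovError c) ∂diskMeasure :=
        setLIntegral_mono_ae' hm hle
    _ ≤ ∫⁻ c, ENNReal.ofReal (Real.exp K ^ (1 / 8 : ℝ)) *
          ENNReal.ofReal (lyapunovError c) ∂diskMeasure := by
        simp only [ENNReal.ofReal_mul (show 0 ≤ Real.exp K ^ (1 / 8 : ℝ) by positivity)]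
        exact setLIntegral_le_lintegral _ _
    _ < ∞ := by
        rw [lintegral_const_mul _ measurable_lyapunovError.ennreal_ofReal]
        exact ENNReal.mul_lt_top ENNReal.ofReal_lt_top lintegral_lyapunovError_lt_top

lemma setLIntegral_preimage_lyapunov_le {s : Set ℂ} (hs : MeasurableSet s) :
    ∫⁻ c in diskMap ⁻¹' s, ENNReal.ofReal (lyapunov c) ∂diskMeasure ≤
      ∫⁻ c in s, ENNReal.ofReal (lyapunov c) ∂diskMeasure +
      ∫⁻ c in diskMap ⁻¹' s, 8 * ENNReal.ofReal (lyapunovError c) ∂diskMeasure := by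
  have hF := continuous_diskMap.measurable
  have hU := measurable_lyapunov.ennreal_ofReal
  have hE := measurable_lyapunovError.ennreal_ofReal
  have hsum : Measurable fun c =>
      ENNReal.ofReal (lyapunov (diskMap c)) + 8 * ENNReal.ofReal (lyapunovError c) :=
    (hU.comp hF).add (hE.const_mul 8)
  have hneg : ∫⁻ c in diskMap ⁻¹' s, ENNReal.ofReal (lyapunov (-c)) ∂diskMeasure =
      ∫⁻ c in diskMap ⁻¹' s, ENNReal.ofReal (lyapunov c) ∂diskMeasure := by
    have h := measurePreserving_neg_diskMeasure.setLIntegral_comp_preimage (hF hs) hU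
    rwa [← preimage_comp, show diskMap ∘ (fun c => -c) = diskMap from funext diskMap_neg] at h
  -- Doubling allows one copy of `U(c)` to be replaced by `U(-c)`, since the preimage is symmetric;
  -- the pointwise inequality can then be integrated.
  rw [← ENNReal.mul_le_mul_iff_right (a := 2) (by norm_num) (by norm_num), two_mul]
  nth_rewrite 2 [← hneg]
  rw [← lintegral_add_left hU, ← measurePreserving_diskMap.setLIntegral_comp_preimage hs hU,
    ← lintegral_add_left (f := fun c => ENNReal.ofReal (lyapunov (diskMap c))) (hU.comp hF),
    ← lintegral_const_mul _ hsum]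
  refine lintegral_mono_ae (ae_restrict_of_ae ?_)
  filter_upwards [ae_diskMeasure_orbit] with c hc
  obtain ⟨h1, h2⟩ := hc 0
  simp only [Function.iterate_zero, id] at h1 h2
  have h := lyapunov_add_neg_le h1 h2
  have hn1 := lyapunov_nonneg h1
  have hn2 := lyapunov_nonneg (c := -c) (by rwa [defect_neg])
  have hn3 : 0 ≤ lyapunov (diskMap c) := lyapunov_nonneg (hc 1).1
  have hn4 : 0 ≤ lyapunovError c := by rw [← rpow_one_eighth_eq h1]; positivity
  rw [← ENNReal.ofReal_add hn1 hn2, mul_add, ← mul_assoc]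
  refine (ENNReal.ofReal_le_ofReal h).trans_eq ?_
  rw [ENNReal.ofReal_add (by positivity) (by positivity), ENNReal.ofReal_mul (by norm_num),
    ENNReal.ofReal_mul (by norm_num)]
  norm_num

theorem conservative_diskMap : Conservative diskMap diskMeasure := by
  refine measurePreserving_diskMap.conservative_of_lyapunov
    measurable_lyapunov.ennreal_ofReal (fun _ => ENNReal.ofReal_ne_top) ?_
    diskMeasure_lyapunov_le_ne_top fun s hs => setLIntegral_preimage_lyapunov_le hs
  rw [lintegral_const_mul _ measurable_lyapunovError.ennreal_ofReal]
  exact ENNReal.mul_ne_top (by norm_num) lintegral_lyapunovError_lt_top.ne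

theorem ae_subseq_tendsto_self : ∀ᵐ c ∂diskMeasure, ∃ n : ℕ → ℕ, StrictMono n ∧
    Tendsto (fun m => diskMap^[n m] c) atTop (𝓝 c) := by
  filter_upwards [conservative_diskMap.ae_frequently_mem_of_mem_nhds] with c hc
  exact (mapClusterPt_iff_frequently.2 hc).tendsto_subseq

/-! ### Transfer to the cylinder. -/

/-- The coordinates `(ξ, θ) = (log (1 - |c|²), arg c)`. -/
noncomputable def cylinderCoord (c : ℂ) : ℝ × ℝ := (Real.log (defect c), Complex.arg c)

/-- The point of the disk with coordinates `(ξ, θ)`. -/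
noncomputable def cylinderPoint (p : ℝ × ℝ) : ℂ :=
  (√(1 - Real.exp p.1) : ℝ) * Complex.exp (p.2 * Complex.I)

lemma defect_cylinderPoint {p : ℝ × ℝ} (hp : p.1 < 0) :
    defect (cylinderPoint p) = Real.exp p.1 := by
  have h : Real.exp p.1 < 1 := by simpa using hp
  rw [defect, cylinderPoint, norm_mul, Complex.norm_exp_ofReal_mul_I, mul_one, Complex.norm_real,
    Real.norm_eq_abs, sq_abs, Real.sq_sqrt (by linarith)]
  ring

lemma cylinderCoord_cylinderPoint {p : ℝ × ℝ} (hp : p ∈ _root_.cylinder) :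
    cylinderCoord (cylinderPoint p) = p := by
  have h : Real.exp p.1 < 1 := by simpa using hp.1
  rw [cylinderCoord, defect_cylinderPoint hp.1, Real.log_exp, cylinderPoint, Complex.exp_mul_I,
    Complex.arg_mul_cos_add_sin_mul_I (Real.sqrt_pos.2 (by linarith)) hp.2]

lemma cylinderMap_cylinderCoord {c : ℂ} (hs : 0 < defect c) (hy : c.im ≠ 0) :
    cylinderMap (cylinderCoord c) = cylinderCoord (diskMap c) := by
  have hc : c ≠ 0 := fun h => hy (by simp [h])
  have hr : 0 < ‖c‖ := norm_pos_iff.2 hc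
  have hsin : Real.sin c.arg = c.im / ‖c‖ := Complex.sin_arg c
  have he : 1 - defect c = ‖c‖ ^ 2 := by rw [defect]; ring
  have hexp : Complex.exp (2 * c.arg * Complex.I) * ((‖c‖ ^ 2 : ℝ) : ℂ) = c ^ 2 := by
    conv_rhs => rw [← Complex.norm_mul_exp_arg_mul_I c, mul_pow, ← Complex.exp_nat_mul]
    push_cast
    rw [mul_comm, mul_assoc]
  rw [cylinderMap, cylinderCoord, cylinderCoord]
  simp only [Real.exp_log hs]
  refine Prod.ext ?_ ?_
  · simp only [angularStep, hsin, he]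
    rw [← Real.log_mul hs.ne' (by positivity), ← Real.log_mul (by positivity) (by positivity),
      defect_diskMap]
    congr 1
    field_simp
  · simp only []
    congr 1
    have hd : (defect c : ℂ) = 1 - ((‖c‖ ^ 2 : ℝ) : ℂ) := by
      rw [defect, Complex.ofReal_sub, Complex.ofReal_one]
    rw [diskMap, ← hexp, hd]
    ring

lemma iterate_cylinderMap_cylinderCoord {c : ℂ}
    (h : ∀ n, 0 < defect (diskMap^[n] c) ∧ (diskMap^[n] c).im ≠ 0) (n : ℕ) :
    cylinderMap^[n] (cylinderCoord c) = cylinderCoord (diskMap^[n] c) := by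
  induction n with
  | zero => rfl
  | succ n ih =>
    rw [Function.iterate_succ_apply', Function.iterate_succ_apply', ih,
      cylinderMap_cylinderCoord (h n).1 (h n).2]

lemma continuousAt_cylinderCoord {c : ℂ} (hs : 0 < defect c) (hy : c.im ≠ 0) :
    ContinuousAt cylinderCoord c :=
  (continuous_defect.continuousAt.log hs.ne').prodMk
    (Complex.continuousAt_arg (Complex.mem_slitPlane_iff.2 (Or.inr hy)))

lemma differentiableAt_cylinderCoord {c : ℂ} (hs : 0 < defect c) (hy : c.im ≠ 0) :
    DifferentiableAt ℝ cylinderCoord c := by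
  have h1 : DifferentiableAt ℝ defect c := by
    unfold defect
    exact (differentiableAt_const _).sub (differentiable_id.norm_sq ℝ c)
  have h2 : DifferentiableAt ℝ Complex.arg c := by
    have := (Complex.differentiableAt_log
      (Complex.mem_slitPlane_iff.2 (Or.inr hy))).restrictScalars ℝ
    have h := Complex.imCLM.differentiableAt.comp c this
    exact h.congr_of_eventuallyEq (Eventually.of_forall fun z => by simp [Complex.log_im])
  exact (h1.log hs.ne').prodMk h2

/-- Null sets of the disk correspond to null sets of the cylinder. -/
lemma ae_cylinder_of_ae_disk {p : ℂ → Prop} (h : ∀ᵐ c ∂diskMeasure, p c) :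
    ∀ᵐ q ∂(volume.restrict _root_.cylinder : Measure (ℝ × ℝ)), p (cylinderPoint q) := by
  have h0 : volume {c : ℂ | (0 < defect c ∧ c.im ≠ 0) ∧ ¬ p c} = 0 := by
    have h1 : ∀ᵐ c ∂volume.restrict (Metric.ball 0 1), p c :=
      absolutelyContinuous_diskMeasure.ae_le h
    rw [ae_restrict_iff' Metric.isOpen_ball.measurableSet] at h1
    refine measure_mono_null ?_ h1
    rintro c ⟨⟨hc, -⟩, hp⟩ hcp
    exact hp (hcp (defect_pos_iff.1 hc))
  set N : Set ℂ := {c | (0 < defect c ∧ c.im ≠ 0) ∧ ¬ p c}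
  have h1 : volume (Complex.measurableEquivRealProd.symm ⁻¹' N) = 0 := by
    rwa [Complex.volume_preserving_equiv_real_prod.symm.measure_preimage_equiv]
  -- Differentiable maps between spaces of equal dimension send null sets to null sets. Removing the
  -- real axis avoids the branch cut of the argument; on the cylinder this costs the null lines `θ =
  -- 0` and `θ = π`.
  have h2 : volume ((fun x => cylinderCoord (Complex.measurableEquivRealProd.symm x)) ''
      (Complex.measurableEquivRealProd.symm ⁻¹' N)) = 0 := by
    refine addHaar_image_eq_zero_of_differentiableOn_of_addHaar_eq_zero volume
      (fun x hx => DifferentiableAt.differentiableWithinAt ?_) h1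
    exact (differentiableAt_cylinderCoord hx.1.1 hx.1.2).comp x
      Complex.equivRealProdCLM.symm.differentiableAt
  have hsin : ∀ a : ℝ, ∀ᵐ q : ℝ × ℝ, q.2 ≠ a := fun a => by
    rw [ae_iff]
    have : {q : ℝ × ℝ | ¬ q.2 ≠ a} = univ ×ˢ {a} := by ext; simp
    rw [this, Measure.volume_eq_prod, Measure.prod_prod]
    simp
  have hcyl : MeasurableSet _root_.cylinder := measurableSet_Iio.prod measurableSet_Ioc
  filter_upwards [ae_restrict_mem hcyl, ae_restrict_of_ae (hsin 0),
    ae_restrict_of_ae (hsin Real.pi), ae_restrict_of_ae (measure_eq_zero_iff_ae_notMem.1 h2)]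
    with q hq hq0 hqpi hqN
  by_contra hp
  refine hqN ⟨Complex.measurableEquivRealProd (cylinderPoint q), ?_, ?_⟩
  · rw [mem_preimage, MeasurableEquiv.symm_apply_apply]
    refine ⟨⟨?_, fun him => ?_⟩, hp⟩
    · rw [defect_cylinderPoint hq.1]; positivity
    · have harg : (cylinderPoint q).arg = q.2 := congrArg Prod.snd (cylinderCoord_cylinderPoint hq)
      rcases le_or_gt 0 (cylinderPoint q).re with hre | hre
      · exact hq0 (harg ▸ Complex.arg_eq_zero_iff.2 ⟨hre, him⟩)
      · exact hqpi (harg ▸ Complex.arg_eq_pi_iff.2 ⟨hre, him⟩)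
  · simp only [MeasurableEquiv.symm_apply_apply]
    exact cylinderCoord_cylinderPoint hq

theorem ae_recurrent_cylinderMap :
    ∀ᵐ p ∂(volume.restrict _root_.cylinder : Measure (ℝ × ℝ)),
      (∃ n : ℕ → ℕ, StrictMono n ∧ Tendsto (fun m => cylinderMap^[n m] p) atTop (𝓝 p)) ∧
      (∃ n : ℕ → ℕ, StrictMono n ∧
        Tendsto (fun m => (cylinderMap^[n m] p).1) atTop atBot) := by
  have hcyl : MeasurableSet _root_.cylinder := measurableSet_Iio.prod measurableSet_Ioc
  filter_upwards [ae_restrict_mem hcyl, ae_cylinder_of_ae_disk ae_diskMeasure_orbit,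
    ae_cylinder_of_ae_disk ae_subseq_tendsto_self,
    ae_cylinder_of_ae_disk ae_subseq_defect_tendsto_zero] with q hq horb hself hzero
  have hiter := iterate_cylinderMap_cylinderCoord horb
  rw [cylinderCoord_cylinderPoint hq] at hiter
  obtain ⟨n, hn, hself⟩ := hself
  obtain ⟨k, hk, hzero⟩ := hzero
  refine ⟨⟨n, hn, ?_⟩, k, hk, ?_⟩
  · have h := (continuousAt_cylinderCoord (horb 0).1 (horb 0).2).tendsto.comp hself
    simp only [Function.iterate_zero, id, cylinderCoord_cylinderPoint hq] at h
    simpa only [hiter, Function.comp_def] using h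
  · simp only [hiter]
    refine Real.tendsto_log_nhdsGT_zero.comp
      (tendsto_nhdsWithin_iff.2 ⟨hzero, Eventually.of_forall fun m => (horb (k m)).1⟩)

theorem ae_recurrent_diskMap :
    ∀ᵐ c ∂(volume.restrict (Metric.ball 0 1) : Measure ℂ),
      (∃ n : ℕ → ℕ, StrictMono n ∧ Tendsto (fun m => diskMap^[n m] c) atTop (𝓝 c)) ∧
      (∃ n : ℕ → ℕ, StrictMono n ∧ Tendsto (fun m => ‖diskMap^[n m] c‖) atTop (𝓝 1)) := by
  refine absolutelyContinuous_diskMeasure.ae_le ?_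
  filter_upwards [ae_subseq_tendsto_self, ae_subseq_defect_tendsto_zero] with c hself hzero
  obtain ⟨k, hk, hzero⟩ := hzero
  refine ⟨hself, k, hk, ?_⟩
  have h := ((tendsto_const_nhds (x := (1 : ℝ))).sub hzero).sqrt
  simpa [defect] using h

end

theorem lemma1 :
    -- the map on the semi-infinite cylinder, with its uniform measure
    (∀ᵐ p ∂(MeasureTheory.volume.restrict cylinder : MeasureTheory.Measure (ℝ × ℝ)),
      (∃ n : ℕ → ℕ, StrictMono n ∧
        Filter.Tendsto (fun m => cylinderMap^[n m] p) Filter.atTop (nhds p)) ∧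
      (∃ n : ℕ → ℕ, StrictMono n ∧
        Filter.Tendsto (fun m => (cylinderMap^[n m] p).1) Filter.atTop Filter.atBot)) ∧
    -- the map on the unit disk, with its area measure
    (∀ᵐ c ∂(MeasureTheory.volume.restrict (Metric.ball 0 1) : MeasureTheory.Measure ℂ),
      (∃ n : ℕ → ℕ, StrictMono n ∧
        Filter.Tendsto (fun m => diskMap^[n m] c) Filter.atTop (nhds c)) ∧
      (∃ n : ℕ → ℕ, StrictMono n ∧
        Filter.Tendsto (fun m => ‖diskMap^[n m] c‖) Filter.atTop (nhds 1))) :=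
  ⟨ae_recurrent_cylinderMap, ae_recurrent_diskMap⟩
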